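/- A size pair $(\mathcal M,\vec\varphi)$ consists of a non-empty compact, locally connected Hausdorff space $\mathcal M$ and a continuous function $\vec\varphi=(\varphi_1,\dots,\varphi_k):\mathcal M\to\mathbb R^k$, $k\ge 1$. For $\vec x\in\mathbb R^k$ put $\mathcal M\langle\vec\varphi\preceq\vec x\rangle=\{P\in\mathcal M:\varphi_i(P)\le x_i,\ i=1,\dots,k\}$. The size function $\ell_{(\mathcal M,\vec\varphi)}$ is defined on $\Delta^+=\{(\vec x,\vec y)\in\mathbb R^k\times\mathbb R^k: x_i<y_i \text{ for all } i\}$: its value $\ell_{(\mathcal M,\vec\varphi)}(\vec x,\vec y)$ is the number of equivalence classes into which $\mathcal M\langle\vec\varphi\preceq\vec x\rangle$ is divided by the relation "$P$ and $Q$ lie in a common connected subset of $\mathcal M\langle\vec\varphi\preceq\vec y\rangle$". A pair $(\vec l,\vec b)\in\mathbb R^k\times\mathbb R^k$ is admissible if $\sum_i l_i^2=1$, $l_i>0$ for every $i$, and $\sum_i b_i=0$. For such a pair let $$F^{\vec\varphi}_{(\vec l,\vec b)}(P)=\max_{i=1,\dots,k}\frac{\varphi_i(P)-b_i}{l_i},\qquad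 P\in\mathcal M .$$ For a size function $\ell$ with $k=1$, the multiplicity of a point $(x,y)$ with $x<y$ is the minimum, over $\varepsilon>0$ with $x+\varepsilon<y-\varepsilon$, of $$\ell(x+\varepsilon,y-\varepsilon)-\ell(x-\varepsilon,y-\varepsilon)-\ell(x+\varepsilon,y+\varepsilon)+\ell(x-\varepsilon,y+\varepsilon),$$ and the multiplicity of $(x,\infty)$ is the minimum, over $\varepsilon>0$ with $x+\varepsilon<1/\varepsilon$, of $\ell(x+\varepsilon,1/\varepsilon)-\ell(x-\varepsilon,1/\varepsilon)$. Let $C_\ell$ be the multiset of all points $(x,y)$, $x<y\le\infty$, of positive multiplicity (the cornerpoints), counted with multiplicity, together with all points $(x,x)$, $x\in\mathbb R$, each counted countably infinitely often. The matching distance is $$d_{match}(\ell_1,\ell_2)=\inf_\sigma\sup_{p\in C_{\ell_1}}\delta(p,\sigma(p))\in[0,\infty],$$ where $\sigma$ ranges over all bijections $C_{\ell_1}\to C_{\ell_2}$ and $$\delta\big((x,y),(x',y')\big)=\min\Big\{\max\{|x-x'|,|y-y'|\},\ \max\big\{\tfrac{y-x}2,\tfrac{y'-x'}2\big\}\Big\},$$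 with the conventions $\infty-\infty=0$, $|\infty-c|=|c-\infty|=\infty$ for real $c$, and $\infty/2=\infty$. **Corollary.** Let $(\mathcal M,\vec\varphi)$ and $(\mathcal N,\vec\psi)$ be size pairs with the same $k\ge1$. Then $\ell_{(\mathcal M,\vec\varphi)}(\vec x,\vec y)=\ell_{(\mathcal N,\vec\psi)}(\vec x,\vec y)$ for all $(\vec x,\vec y)\in\Delta^+$ if and only if $$d_{match}\big(\ell_{(\mathcal M,F^{\vec\varphi}_{(\vec l,\vec b)})},\ \ell_{(\mathcal N,F^{\vec\psi}_{(\vec l,\vec b)})}\big)=0\quad\text{for every admissible pair }(\vec l,\vec b).$$ -/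

import Mathlib

open scoped ENNReal

namespace SizeTheory

section SizeFunctions

variable {X : Type*} {E : Type*} [Preorder E]

/-- The lower level set `M⟨φ ≤ x⟩`. With `E = Fin k → ℝ` the order is the componentwise one
(a `k`-dimensional measuring function), with `E = ℝ` it is the usual one. -/
def sublevel (φ : X → E) (x : E) : Set X := {P | φ P ≤ x}

variable [TopologicalSpace X]

/-- `P` and `Q` are `⟨φ ≤ y⟩`-connected: some connected subset of `M⟨φ ≤ y⟩` contains both. -/
def LevelConnected (φ : X → E) (y : E) (P Q : X) : Prop :=
  ∃ C : Set X, C ⊆ sublevel φ y ∧ IsConnected C ∧ P ∈ C ∧ Q ∈ C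

/-- The classes into which `M⟨φ ≤ x⟩` is divided by `⟨φ ≤ y⟩`-connectedness. -/
def levelClasses (φ : X → E) (x y : E) : Set (Set X) :=
  {S | ∃ P ∈ sublevel φ x, S = {Q | Q ∈ sublevel φ x ∧ LevelConnected φ y P Q}}

/-- The size function of `(X, φ)`: the number of classes of `M⟨φ ≤ x⟩` under
`⟨φ ≤ y⟩`-connectedness. It is only ever used at points `(x, y)` of the open region `Δ⁺`
(all coordinates of `x` strictly below those of `y`), where the number is finite
(see `levelClasses_finite_pi` and `levelClasses_finite_real`). -/
noncomputable def sizeFunction (φ : X → E) (x y : E) : ℕ := (levelClasses φ x y).ncard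

/-- On `M⟨φ ≤ x⟩` with `x ≤ y`, being `⟨φ ≤ y⟩`-connected is an equivalence relation. -/
theorem levelConnected_equivalence (φ : X → E) {x y : E} (hxy : x ≤ y) :
    Equivalence (fun P Q : sublevel φ x => LevelConnected φ y P.1 Q.1) where
  refl P := ⟨{P.1}, Set.singleton_subset_iff.2 (le_trans P.2 hxy), isConnected_singleton,
    rfl, rfl⟩
  symm := fun ⟨C, h1, h2, h3, h4⟩ => ⟨C, h1, h2, h4, h3⟩
  trans := fun ⟨C, h1, h2, h3, h4⟩ ⟨D, k1, k2, k3, k4⟩ =>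
    ⟨C ∪ D, Set.union_subset h1 k1, IsConnected.union ⟨_, h4, k3⟩ h2 k2, Or.inl h3, Or.inr k4⟩

theorem levelClasses_finite [CompactSpace X] [LocallyConnectedSpace X] (φ : X → E) {x y : E}
    (hx : IsClosed (sublevel φ x)) (hxy : sublevel φ x ⊆ interior (sublevel φ y)) :
    (levelClasses φ x y).Finite := by
  have hloc : ∀ P ∈ sublevel φ x, ∃ V : Set X, V ⊆ interior (sublevel φ y) ∧ IsOpen V ∧
      P ∈ V ∧ IsConnected V := fun P hP =>
    locallyConnectedSpace_iff_subsets_isOpen_isConnected.1 inferInstance P _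
      (isOpen_interior.mem_nhds (hxy hP))
  choose! V hVs hVo hVP hVc using hloc
  obtain ⟨t, hcov⟩ := hx.isCompact.elim_nhds_subcover' (fun P _ => V P)
    (fun P hP => (hVo P hP).mem_nhds (hVP P hP))
  refine (t.finite_toSet.image fun P => {Q | Q ∈ sublevel φ x ∧ LevelConnected φ y P.1 Q}).subset ?_
  rintro S ⟨P, hP, rfl⟩
  obtain ⟨R, hR, hPR⟩ := Set.mem_iUnion₂.1 (hcov hP)
  have hRP : LevelConnected φ y R.1 P :=
    ⟨V R.1, (hVs _ R.2).trans interior_subset, hVc _ R.2, hVP _ R.2, hPR⟩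
  refine ⟨R, hR, Set.ext fun Q => and_congr_right fun _ => ⟨?_, ?_⟩⟩
  · rintro ⟨C, h1, h2, h3, h4⟩
    obtain ⟨D, k1, k2, k3, k4⟩ := hRP
    exact ⟨C ∪ D, Set.union_subset h1 k1, IsConnected.union ⟨_, h3, k3⟩ h2 k2, Or.inr k4,
      Or.inl h4⟩
  · rintro ⟨C, h1, h2, h3, h4⟩
    obtain ⟨D, k1, k2, k3, k4⟩ := hRP
    exact ⟨C ∪ D, Set.union_subset h1 k1, IsConnected.union ⟨_, h3, k4⟩ h2 k2, Or.inr k3,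
      Or.inl h4⟩

theorem levelClasses_finite_pi [CompactSpace X] [LocallyConnectedSpace X] {k : ℕ}
    {φ : X → Fin k → ℝ} (hφ : Continuous φ) {x y : Fin k → ℝ} (hxy : ∀ i, x i < y i) :
    (levelClasses φ x y).Finite := by
  refine levelClasses_finite φ (isClosed_Iic.preimage hφ) fun P hP => ?_
  have ho : IsOpen {Q | ∀ i, φ Q i < y i} := by
    simp only [Set.ofPred_forall]
    exact isOpen_iInter_of_finite fun i =>
      isOpen_lt ((continuous_apply i).comp hφ) continuous_const
  exact interior_maximal (fun Q hQ i => (hQ i).le) ho fun i => (hP i).trans_lt (hxy i)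

theorem levelClasses_finite_real [CompactSpace X] [LocallyConnectedSpace X]
    {φ : X → ℝ} (hφ : Continuous φ) {x y : ℝ} (hxy : x < y) :
    (levelClasses φ x y).Finite :=
  levelClasses_finite φ (isClosed_Iic.preimage hφ) fun _ hP =>
    interior_maximal (fun _ hQ => le_of_lt hQ) (isOpen_Iio.preimage hφ) (lt_of_le_of_lt hP hxy)

end SizeFunctions

section Foliation

/-- `(l, b)` is admissible: `l` is a (Euclidean) unit vector with positive coordinates, and the
coordinates of `b` sum to zero. -/
def Admissible {k : ℕ} (l b : Fin k → ℝ) : Prop :=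
  (∑ i, l i ^ 2 = 1) ∧ (∀ i, 0 < l i) ∧ ∑ i, b i = 0

/-- The function `F(P) = max_i (φ_i(P) - b_i) / l_i`; the supremum is a maximum over the
finite index set `Fin k`, which is non-empty where this is used. -/
noncomputable def foliationFunction {X : Type*} {k : ℕ} (φ : X → Fin k → ℝ) (l b : Fin k → ℝ)
    (P : X) : ℝ :=
  ⨆ i, (φ P i - b i) / l i

end Foliation

section MatchingDistance

/-- Points of the extended plane: `proper x y` is `(x, y)`, `atInfinity k` is `(k, ∞)`, which
stands for the vertical line `x = k`. -/
inductive ExtPoint : Type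
  | proper (x y : ℝ)
  | atInfinity (k : ℝ)

/-- The multiplicity of `(x, y)`, `x < y`: the minimum, over `ε > 0` with `x + ε < y - ε`, of
`ℓ(x+ε, y-ε) - ℓ(x-ε, y-ε) - ℓ(x+ε, y+ε) + ℓ(x-ε, y+ε)`. For a size function these integers are
non-negative. -/
noncomputable def properMult (ℓ : ℝ → ℝ → ℕ) (x y : ℝ) : ℕ :=
  sInf {n : ℕ | ∃ ε : ℝ, 0 < ε ∧ x + ε < y - ε ∧
    (n : ℤ) = ℓ (x + ε) (y - ε) - ℓ (x - ε) (y - ε) - ℓ (x + ε) (y + ε) + ℓ (x - ε) (y + ε)}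

/-- The multiplicity of the vertical line `x = k`, that is of `(k, ∞)`: the minimum, over `ε > 0`
with `k + ε < 1/ε`, of `ℓ(k+ε, 1/ε) - ℓ(k-ε, 1/ε)`. -/
noncomputable def infinityMult (ℓ : ℝ → ℝ → ℕ) (k : ℝ) : ℕ :=
  sInf {n : ℕ | ∃ ε : ℝ, 0 < ε ∧ k + ε < 1 / ε ∧
    (n : ℤ) = ℓ (k + ε) (1 / ε) - ℓ (k - ε) (1 / ε)}

open Classical in
/-- Multiplicities in the multiset of cornerpoints of `ℓ`, augmented by the points of the diagonal
with (countably) infinite multiplicity. A cornerpoint is a point, proper or at infinity, with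
positive multiplicity. -/
noncomputable def mult (ℓ : ℝ → ℝ → ℕ) : ExtPoint → ℕ∞
  | .proper x y => if x < y then (properMult ℓ x y : ℕ∞) else if x = y then ⊤ else 0
  | .atInfinity k => (infinityMult ℓ k : ℕ∞)

/-- The augmented multiset of cornerpoints, as the type of its elements: the point `p` occurs
in `mult ℓ p` copies. -/
def Diagram (ℓ : ℝ → ℝ → ℕ) : Type :=
  Σ p : ExtPoint, {n : ℕ // (n : ℕ∞) < mult ℓ p}

/-- The pseudo-distance `min (max |x-x'| |y-y'|) (max ((y-x)/2) ((y'-x')/2))`, extended to points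
at infinity by the conventions `∞ - ∞ = 0`, `∞ - y = ∞`, `∞ / 2 = ∞`. -/
noncomputable def pointCost : ExtPoint → ExtPoint → ℝ≥0∞
  | .proper x y, .proper x' y' =>
      ENNReal.ofReal (min (max |x - x'| |y - y'|) (max ((y - x) / 2) ((y' - x') / 2)))
  | .atInfinity k, .atInfinity k' => ENNReal.ofReal |k - k'|
  | .proper _ _, .atInfinity _ => ⊤
  | .atInfinity _, .proper _ _ => ⊤

/-- The matching distance between 1-dimensional size functions: the infimum, over all bijections
between the augmented multisets of cornerpoints, of the largest displacement. It may be `∞`.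
It depends only on the values `ℓ x y` with `x < y`. -/
noncomputable def matchingDist (ℓ₁ ℓ₂ : ℝ → ℝ → ℕ) : ℝ≥0∞ :=
  ⨅ σ : Diagram ℓ₁ ≃ Diagram ℓ₂, ⨆ c : Diagram ℓ₁, pointCost c.1 (σ c).1

end MatchingDistance

end SizeTheory

/-!
Restricted to the leaf `s ↦ (s • l + b)` of an admissible pair, the size function of `φ` is the
size function of the real-valued function `foliationFunction φ l b`, and every point of `Δ⁺` lies
on some leaf. So it suffices to show that a one-dimensional size function `ℓ` is determined on
`s < t` by its cornerpoints up to matching distance zero.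

The value `ℓ s t` is the number of cornerpoints, with multiplicity, in the quadrant `x ≤ s`,
`t < y`. Indeed `ℓ · t` is a right-continuous increasing step function starting from `0`, so
`ℓ s t` is the sum of its left jumps at the points `x ≤ s`. For fixed `x` that jump is a
right-continuous decreasing step function of `t`, which drops by the multiplicity of `(x, t)` at
`t` and eventually equals the multiplicity of `(x, ∞)`. A matching that moves every point by less
than `ε` carries the quadrant of `(s, t + ε)` into that of `(s + ε, t)`, hence
`ℓ₁ s (t + ε) ≤ ℓ₂ (s + ε) t`, and right continuity allows `ε → 0`.
-/

namespace SizeTheory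

open Set Filter Topology

section CompactConnected

variable {X : Type*} [TopologicalSpace X]

theorem isPreconnected_iInter_of_directed [T2Space X] {ι : Type*} [Nonempty ι] {K : ι → Set X}
    (hdir : Directed (· ⊇ ·) K) (hcpt : ∀ i, IsCompact (K i)) (hconn : ∀ i, IsPreconnected (K i)) :
    IsPreconnected (⋂ i, K i) := by
  have hcptI : IsCompact (⋂ i, K i) := (hcpt (Classical.arbitrary ι)).of_isClosed_subset
    (isClosed_iInter fun i => (hcpt i).isClosed) (iInter_subset K _)
  rw [isPreconnected_iff_subset_of_fully_disjoint_closed hcptI.isClosed]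
  intro A B hA hB hAB hdisj
  obtain ⟨U, V, hU, hV, hAU, hBV, hUV⟩ := SeparatedNhds.of_isCompact_isCompact
    (hcptI.inter_right hA) (hcptI.inter_right hB) (hdisj.mono inter_subset_right inter_subset_right)
  have hcover : ⋂ i, K i ⊆ U ∪ V := fun x hx =>
    (hAB hx).imp (fun hxA => hAU ⟨hx, hxA⟩) fun hxB => hBV ⟨hx, hxB⟩
  obtain ⟨i, hi⟩ := exists_subset_nhds_of_isCompact hdir hcpt fun x hx =>
    (hU.union hV).mem_nhds (hcover hx)
  refine (IsPreconnected.subset_or_subset hU hV hUV hi (hconn i)).imp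
    (fun hKU x hx => (hAB hx).resolve_right fun hxB => ?_)
    fun hKV x hx => (hAB hx).resolve_left fun hxA => ?_
  · exact disjoint_left.1 hUV (hKU (mem_iInter.1 hx i)) (hBV ⟨hx, hxB⟩)
  · exact disjoint_left.1 hUV (hAU ⟨hx, hxA⟩) (hKV (mem_iInter.1 hx i))

theorem isClosed_connectedComponentIn {F : Set X} (hF : IsClosed F) (P : X) :
    IsClosed (connectedComponentIn F P) := by
  by_cases hP : P ∈ F
  · rw [connectedComponentIn_eq_image hP]
    exact hF.isClosedEmbedding_subtypeVal.isClosedMap _ isClosed_connectedComponent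
  · simp only [connectedComponentIn_eq_empty hP, isClosed_empty]

theorem biUnion_connectedComponentIn {A B : Set X} (hAB : A ⊆ B) {P : X} (hP : P ∈ A) :
    ⋃ Q ∈ connectedComponentIn A P, connectedComponentIn B Q = connectedComponentIn B P :=
  (iUnion₂_congr fun _ hQ =>
    (connectedComponentIn_eq (connectedComponentIn_mono P hAB hQ)).symm).trans
    (biUnion_const ⟨P, mem_connectedComponentIn hP⟩ _)

end CompactConnected

section SizeFunctions

variable {X E : Type*} [Preorder E]

theorem sublevel_mono (φ : X → E) : Monotone (sublevel φ) := fun _ _ hxy _ hP => le_trans hP hxy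

variable [TopologicalSpace X]

theorem levelConnected_iff_mem_connectedComponentIn {φ : X → E} {y : E} {P Q : X}
    (hP : P ∈ sublevel φ y) :
    LevelConnected φ y P Q ↔ Q ∈ connectedComponentIn (sublevel φ y) P :=
  ⟨fun ⟨_, hC, hconn, hPC, hQC⟩ => hconn.isPreconnected.subset_connectedComponentIn hPC hC hQC,
    fun hQ => ⟨_, connectedComponentIn_subset _ _, isConnected_connectedComponentIn_iff.2 hP,
      mem_connectedComponentIn hP, hQ⟩⟩

/-- The connected components of `M⟨φ ≤ y⟩` that meet `M⟨φ ≤ x⟩`, for `x ≤ y`. -/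
def levelComponents (φ : X → E) (x y : E) : Set (Set X) :=
  connectedComponentIn (sublevel φ y) '' sublevel φ x

theorem bijOn_levelComponents_levelClasses (φ : X → E) {x y : E} (hxy : x ≤ y) :
    BijOn (sublevel φ x ∩ ·) (levelComponents φ x y) (levelClasses φ x y) := by
  have hclass : ∀ P ∈ sublevel φ x, {Q | Q ∈ sublevel φ x ∧ LevelConnected φ y P Q} =
      sublevel φ x ∩ connectedComponentIn (sublevel φ y) P := fun P hP => ext fun Q =>
    and_congr_right' (levelConnected_iff_mem_connectedComponentIn (sublevel_mono φ hxy hP))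
  refine ⟨?_, ?_, ?_⟩
  · rintro _ ⟨P, hP, rfl⟩
    exact ⟨P, hP, (hclass P hP).symm⟩
  · rintro _ ⟨P, hP, rfl⟩ _ ⟨Q, -, rfl⟩ hPQ
    have hmem : P ∈ sublevel φ x ∩ connectedComponentIn (sublevel φ y) P :=
      ⟨hP, mem_connectedComponentIn (sublevel_mono φ hxy hP)⟩
    exact (connectedComponentIn_eq (hPQ.subset hmem).2).symm
  · rintro _ ⟨P, hP, rfl⟩
    exact ⟨_, mem_image_of_mem _ hP, (hclass P hP).symm⟩

theorem sizeFunction_eq_ncard_levelComponents (φ : X → E) {x y : E} (hxy : x ≤ y) :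
    sizeFunction φ x y = (levelComponents φ x y).ncard :=
  (bijOn_levelComponents_levelClasses φ hxy).ncard_eq.symm

theorem levelComponents_subset_levelComponents (φ : X → E) {x₁ x₂ : E} (hx : x₁ ≤ x₂) (y : E) :
    levelComponents φ x₁ y ⊆ levelComponents φ x₂ y :=
  image_mono (sublevel_mono φ hx)

/-- The map induced by the inclusion `M⟨φ ≤ y⟩ ⊆ M⟨φ ≤ z⟩`, for `y ≤ z`, from the components of
the former to those of the latter: it sends `C` to the component containing `C`. -/
def componentMap (φ : X → E) (z : E) (C : Set X) : Set X :=
  ⋃ Q ∈ C, connectedComponentIn (sublevel φ z) Q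

theorem componentMap_connectedComponentIn (φ : X → E) {y z : E} (hyz : y ≤ z) {P : X}
    (hP : P ∈ sublevel φ y) :
    componentMap φ z (connectedComponentIn (sublevel φ y) P) =
      connectedComponentIn (sublevel φ z) P :=
  biUnion_connectedComponentIn (sublevel_mono φ hyz) hP

theorem image_componentMap_levelComponents (φ : X → E) {x y z : E} (hxy : x ≤ y) (hyz : y ≤ z) :
    componentMap φ z '' levelComponents φ x y = levelComponents φ x z := by
  rw [levelComponents, image_image]
  exact image_congr fun P hP =>
    componentMap_connectedComponentIn φ hyz (sublevel_mono φ hxy hP)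

theorem ncard_image_add_ncard_le {α β : Type*} (g : α → β) {A B : Set α} (hAB : A ⊆ B)
    (hB : B.Finite) : (g '' B).ncard + A.ncard ≤ B.ncard + (g '' A).ncard := by
  have hsub : g '' B \ g '' A ⊆ g '' (B \ A) := by
    rintro _ ⟨⟨C, hC, rfl⟩, hCA⟩
    exact ⟨C, ⟨hC, fun h => hCA ⟨C, h, rfl⟩⟩, rfl⟩
  have hle : (g '' B \ g '' A).ncard ≤ (B \ A).ncard :=
    (ncard_le_ncard hsub (hB.sdiff.image g)).trans (ncard_image_le hB.sdiff)
  have hA := ncard_sdiff_add_ncard_of_subset hAB hB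
  have hgA := ncard_sdiff_add_ncard_of_subset (image_mono (f := g) hAB) (hB.image g)
  omega

end SizeFunctions

section RealSizeFunctions

variable {X : Type*} [TopologicalSpace X] [CompactSpace X] {f : X → ℝ}

theorem eventually_sublevel_subset (hf : Continuous f) {x : ℝ} {W : Set X} (hW : IsOpen W)
    (hxW : sublevel f x ⊆ W) : ∀ᶠ u in 𝓝[>] x, sublevel f u ⊆ W := by
  obtain hcompl | hcompl := Wᶜ.eq_empty_or_nonempty
  · simp only [compl_empty_iff.1 hcompl, subset_univ, eventually_true]
  · obtain ⟨P, hP, hmin⟩ := hW.isClosed_compl.isCompact.exists_isMinOn hcompl hf.continuousOn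
    have hxP : x < f P := not_le.1 fun hle => hP (hxW hle)
    filter_upwards [Ioo_mem_nhdsGT hxP] with u hu Q hQ
    by_contra hQW
    exact ((hmin hQW).trans hQ).not_gt hu.2

theorem eventually_connectedComponentIn_ne [T2Space X] (hf : Continuous f) {y : ℝ} {P Q : X}
    (hP : P ∈ sublevel f y) (hQ : Q ∈ sublevel f y)
    (hPQ : connectedComponentIn (sublevel f y) P ≠ connectedComponentIn (sublevel f y) Q) :
    ∀ᶠ v in 𝓝[>] y,
      connectedComponentIn (sublevel f v) P ≠ connectedComponentIn (sublevel f v) Q := by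
  contrapose! hPQ
  let K : Ioi y → Set X := fun v => connectedComponentIn (sublevel f v) P
  have hK_mono : Monotone K := fun v w hvw => connectedComponentIn_mono P (sublevel_mono f hvw)
  have hK_compact (v : Ioi y) : IsCompact (K v) :=
    (isClosed_connectedComponentIn (isClosed_Iic.preimage hf) P).isCompact
  have hK_connected : IsPreconnected (⋂ v, K v) := isPreconnected_iInter_of_directed
    hK_mono.directed_ge hK_compact fun _ => isPreconnected_connectedComponentIn
  have hK_sub : ⋂ v, K v ⊆ sublevel f y := fun R hR => le_of_forall_gt_imp_ge_of_dense fun v hv =>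
    show f R ≤ v from connectedComponentIn_subset (sublevel f v) P (mem_iInter.1 hR ⟨v, hv⟩)
  have hPK : P ∈ ⋂ v, K v := mem_iInter.2 fun v =>
    mem_connectedComponentIn (sublevel_mono f v.2.le hP)
  have hQK : Q ∈ ⋂ v, K v := by
    refine mem_iInter.2 fun v => ?_
    obtain ⟨w, hw, hyw, hwv⟩ := (hPQ.and_eventually (Ioo_mem_nhdsGT v.2)).exists
    have hQw : Q ∈ connectedComponentIn (sublevel f w) P :=
      hw ▸ mem_connectedComponentIn (sublevel_mono f hyw.le hQ)
    exact hK_mono (a := ⟨w, hyw⟩) hwv.le hQw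
  exact connectedComponentIn_eq (hK_connected.subset_connectedComponentIn hPK hK_sub hQK)

variable [LocallyConnectedSpace X]

theorem finite_levelComponents (hf : Continuous f) {x y : ℝ} (hxy : x < y) :
    (levelComponents f x y).Finite :=
  (bijOn_levelComponents_levelClasses f hxy.le).finite_iff_finite.2
    (levelClasses_finite_real hf hxy)

theorem eventually_levelComponents_eq (hf : Continuous f) {x y : ℝ} (hxy : x < y) :
    ∀ᶠ u in 𝓝[>] x, levelComponents f u y = levelComponents f x y := by
  have hopen : IsOpen {Q | f Q < y} := isOpen_Iio.preimage hf
  let W : Set X := ⋃ P ∈ sublevel f x, connectedComponentIn {Q | f Q < y} P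
  have hW : IsOpen W := isOpen_biUnion fun P _ => hopen.connectedComponentIn
  have hxW : sublevel f x ⊆ W := fun P hP =>
    mem_biUnion hP (mem_connectedComponentIn (lt_of_le_of_lt hP hxy))
  filter_upwards [eventually_sublevel_subset hf hW hxW, self_mem_nhdsWithin] with u huW hxu
  refine Subset.antisymm ?_ (levelComponents_subset_levelComponents f (le_of_lt hxu) y)
  rintro _ ⟨Q, hQ, rfl⟩
  obtain ⟨P, hP, hQP⟩ := mem_iUnion₂.1 (huW hQ)
  exact ⟨P, hP, connectedComponentIn_eq
    (connectedComponentIn_mono P (fun R (hR : f R < y) => hR.le) hQP)⟩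

theorem eventually_injOn_componentMap [T2Space X] (hf : Continuous f) {x y : ℝ} (hxy : x < y) :
    ∀ᶠ v in 𝓝[>] y, InjOn (componentMap f v) (levelComponents f x y) := by
  have hfin := finite_levelComponents hf hxy
  refine (eventually_all_finite hfin).2 fun C hC => (eventually_all_finite hfin).2 fun D hD => ?_
  obtain ⟨P, hPx, rfl⟩ := hC
  obtain ⟨Q, hQx, rfl⟩ := hD
  have hP := sublevel_mono f hxy.le hPx
  have hQ := sublevel_mono f hxy.le hQx
  by_cases hPQ : connectedComponentIn (sublevel f y) P = connectedComponentIn (sublevel f y) Q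
  · exact Eventually.of_forall fun _ _ => hPQ
  · filter_upwards [eventually_connectedComponentIn_ne hf hP hQ hPQ, self_mem_nhdsWithin]
      with v hne hyv heq
    rw [componentMap_connectedComponentIn f (le_of_lt hyv) hP,
      componentMap_connectedComponentIn f (le_of_lt hyv) hQ] at heq
    exact absurd heq hne

end RealSizeFunctions

/-- The properties, on `x < y`, of the size function of a real-valued measuring function that make
it a count of cornerpoints. Continuity of a function to `ℕ` is expressed as eventual constancy. -/
structure IsRankFunction (ℓ : ℝ → ℝ → ℕ) : Prop where
  monotone_left : ∀ {x₁ x₂ y}, x₁ ≤ x₂ → x₂ < y → ℓ x₁ y ≤ ℓ x₂ y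
  rectangle_nonneg : ∀ {x₁ x₂ y₁ y₂}, x₁ ≤ x₂ → x₂ < y₁ → y₁ ≤ y₂ →
    ℓ x₂ y₂ + ℓ x₁ y₁ ≤ ℓ x₂ y₁ + ℓ x₁ y₂
  eventually_left_eq : ∀ {x y}, x < y → ∀ᶠ u in 𝓝[>] x, ℓ u y = ℓ x y
  eventually_right_eq : ∀ {x y}, x < y → ∀ᶠ v in 𝓝[>] y, ℓ x v = ℓ x y
  exists_eq_zero : ∃ a, ∀ {x y}, x ≤ a → x < y → ℓ x y = 0
  exists_eq_of_le : ∃ B, ∀ {x y y'}, B ≤ y → B ≤ y' → x < y → x < y' → ℓ x y = ℓ x y'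

theorem isRankFunction_sizeFunction {X : Type*} [TopologicalSpace X] [CompactSpace X]
    [LocallyConnectedSpace X] [T2Space X] {f : X → ℝ} (hf : Continuous f) :
    IsRankFunction (sizeFunction f) where
  monotone_left {x₁ x₂ y} hx hxy := by
    rw [sizeFunction_eq_ncard_levelComponents f (hx.trans hxy.le),
      sizeFunction_eq_ncard_levelComponents f hxy.le]
    exact ncard_le_ncard (levelComponents_subset_levelComponents f hx y)
      (finite_levelComponents hf hxy)
  rectangle_nonneg {x₁ x₂ y₁ y₂} hx hxy hy := by
    simp only [sizeFunction_eq_ncard_levelComponents f, hxy.le, hx.trans hxy.le, hxy.le.trans hy,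
      hx.trans (hxy.le.trans hy), ← image_componentMap_levelComponents f _ hy]
    exact ncard_image_add_ncard_le _ (levelComponents_subset_levelComponents f hx y₁)
      (finite_levelComponents hf hxy)
  eventually_left_eq {x y} hxy := by
    filter_upwards [eventually_levelComponents_eq hf hxy, Ioo_mem_nhdsGT hxy] with u heq hu
    rw [sizeFunction_eq_ncard_levelComponents f hu.2.le,
      sizeFunction_eq_ncard_levelComponents f hxy.le, heq]
  eventually_right_eq {x y} hxy := by
    filter_upwards [eventually_injOn_componentMap hf hxy, self_mem_nhdsWithin] with v hinj hyv
    rw [sizeFunction_eq_ncard_levelComponents f (hxy.trans hyv).le,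
      sizeFunction_eq_ncard_levelComponents f hxy.le,
      ← image_componentMap_levelComponents f hxy.le (le_of_lt hyv), hinj.ncard_image]
  exists_eq_zero := by
    obtain ⟨m, hm⟩ := (isCompact_range hf).bddBelow
    refine ⟨m - 1, fun {x y} hx hxy => ?_⟩
    have hempty : sublevel f x = ∅ := eq_empty_of_forall_notMem fun Q hQ => by
      linarith [hm (mem_range_self Q), show f Q ≤ x from hQ]
    rw [sizeFunction_eq_ncard_levelComponents f hxy.le, levelComponents, hempty, image_empty,
      ncard_empty]
  exists_eq_of_le := by
    obtain ⟨B, hB⟩ := (isCompact_range hf).bddAbove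
    have huniv : ∀ {y}, B ≤ y → sublevel f y = univ := fun hy =>
      eq_univ_of_forall fun Q => (hB (mem_range_self Q)).trans hy
    refine ⟨B, fun {x y y'} hy hy' hxy hxy' => ?_⟩
    simp only [sizeFunction_eq_ncard_levelComponents f, hxy.le, hxy'.le, levelComponents, huniv hy,
      huniv hy']

section StepFunctions

open Cardinal

variable {α : Type*} [ConditionallyCompleteLinearOrder α] [TopologicalSpace α] [OrderTopology α]
  {h j : α → ℕ} {a s : α}

theorem exists_mem_Ioc_first_gt {n : ℕ}
    (hright : ∀ x ∈ Ico a s, ∀ᶠ z in 𝓝[>] x, h z = h x) (has : a ≤ s) (han : h a ≤ n)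
    (hns : n < h s) : ∃ x ∈ Ioc a s, n < h x ∧ ∀ z ∈ Ico a x, h z ≤ n := by
  let A : Set α := {x ∈ Icc a s | n < h x}
  have hsA : s ∈ A := ⟨right_mem_Icc.2 has, hns⟩
  have hA_bdd : BddBelow A := ⟨a, fun x hx => hx.1.1⟩
  have ha_le : a ≤ sInf A := le_csInf ⟨s, hsA⟩ fun x hx => hx.1.1
  have hle_s : sInf A ≤ s := csInf_le hA_bdd hsA
  have hbelow : ∀ z ∈ Ico a (sInf A), h z ≤ n := fun z hz => not_lt.1 fun hnz =>
    hz.2.not_ge (csInf_le hA_bdd ⟨⟨hz.1, hz.2.le.trans hle_s⟩, hnz⟩)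
  have hmem : n < h (sInf A) := by
    by_contra hn
    have hlt : sInf A < s := hle_s.lt_of_ne fun heq => hn (heq ▸ hns)
    obtain ⟨u, hu, hconst⟩ := (mem_nhdsGT_iff_exists_Ioo_subset' hlt).1 (hright _ ⟨ha_le, hlt⟩)
    obtain ⟨x, hxA, hxu⟩ := exists_lt_of_csInf_lt ⟨s, hsA⟩ hu
    have hlt_x : sInf A < x := (csInf_le hA_bdd hxA).lt_of_ne fun heq => hn (heq ▸ hxA.2)
    have hx : h x = h (sInf A) := hconst ⟨hlt_x, hxu⟩
    exact hn (hx ▸ hxA.2)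
  exact ⟨sInf A, ⟨ha_le.lt_of_ne fun heq => (heq ▸ hmem).not_ge han, hle_s⟩, hmem, hbelow⟩

/-- The jump of `h` at `x` from the left. It is used where `h` is increasing up to `x`, so that the
subtraction is not truncated. -/
noncomputable def leftJump (h : α → ℕ) (x : α) : ℕ := h x - Function.leftLim h x

theorem eventually_add_leftJump {x : α} [(𝓝[<] x).NeBot] (hmono : MonotoneOn h (Iic x)) :
    ∀ᶠ z in 𝓝[<] x, h z + leftJump h x = h x := by
  have hbdd : h x ∈ upperBounds (h '' Iio x) :=
    forall_mem_image.2 fun z hz => hmono (le_of_lt hz) self_mem_Iic (le_of_lt hz)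
  have htendsto := (hmono.mono Iio_subset_Iic_self).tendsto_nhdsLT ⟨_, hbdd⟩
  rw [← leftLim_eq_of_tendsto htendsto, nhds_discrete, tendsto_pure] at htendsto
  filter_upwards [htendsto, self_mem_nhdsWithin] with z hz hzx
  have hle := hbdd (mem_image_of_mem h hzx)
  rw [leftJump, ← hz, Nat.add_sub_cancel' hle]

variable [DenselyOrdered α]

theorem exists_add_eq_of_eventually (hleft : ∀ x ∈ Ioc a s, ∀ᶠ z in 𝓝[<] x, h z + j x = h x)
    {x y : α} (hx : x ∈ Ioc a s) (hyx : y < x) : ∃ z ∈ Ioo y x, h z + j x = h x := by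
  have : (𝓝[<] x).NeBot := nhdsLT_neBot_of_exists_lt ⟨y, hyx⟩
  exact (Eventually.and (Ioo_mem_nhdsLT hyx) (hleft x hx)).exists

theorem existsUnique_mem_Ico_jump (hmono : MonotoneOn h (Icc a s))
    (hright : ∀ x ∈ Ico a s, ∀ᶠ z in 𝓝[>] x, h z = h x)
    (hleft : ∀ x ∈ Ioc a s, ∀ᶠ z in 𝓝[<] x, h z + j x = h x) (has : a ≤ s) {n : ℕ}
    (hn : n ∈ Ico (h a) (h s)) : ∃! x, x ∈ Ioc a s ∧ n ∈ Ico (h x - j x) (h x) := by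
  have hle_of_lt : ∀ {x y : α}, x ∈ Ioc a s → y ∈ Ioc a s → y < x → h y ≤ h x - j x := by
    intro x y hx hy hyx
    obtain ⟨z, hz, hzx⟩ := exists_add_eq_of_eventually hleft hx hyx
    have := hmono ⟨hy.1.le, hy.2⟩ ⟨(hy.1.trans hz.1).le, hz.2.le.trans hx.2⟩ hz.1.le
    omega
  obtain ⟨x, hx, hnx, hbelow⟩ := exists_mem_Ioc_first_gt hright has hn.1 hn.2
  refine ⟨x, ⟨hx, ?_, hnx⟩, ?_⟩
  · obtain ⟨z, hz, hzx⟩ := exists_add_eq_of_eventually hleft hx hx.1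
    have := hbelow z ⟨hz.1.le, hz.2⟩
    omega
  · rintro y ⟨hy, hny, hny'⟩
    refine le_antisymm (not_lt.1 fun hlt => ?_) (not_lt.1 fun hlt => ?_)
    · exact hnx.not_ge ((hle_of_lt hy hx hlt).trans hny)
    · exact hny'.not_ge (hbelow y ⟨hy.1.le, hlt⟩)

theorem mk_sigma_fin_jump_Ioc (hmono : MonotoneOn h (Icc a s))
    (hright : ∀ x ∈ Ico a s, ∀ᶠ z in 𝓝[>] x, h z = h x)
    (hleft : ∀ x ∈ Ioc a s, ∀ᶠ z in 𝓝[<] x, h z + j x = h x) (has : a ≤ s) :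
    #(Σ x : Ioc a s, Fin (j x)) = (h s - h a : ℕ) := by
  have hle : ∀ x ∈ Ioc a s, h a + j x ≤ h x ∧ h x ≤ h s := fun x hx => by
    obtain ⟨z, hz, hzx⟩ := exists_add_eq_of_eventually hleft hx hx.1
    have := hmono (left_mem_Icc.2 has) ⟨hz.1.le, hz.2.le.trans hx.2⟩ hz.1.le
    exact ⟨by omega, hmono ⟨hx.1.le, hx.2⟩ (right_mem_Icc.2 has) hx.2⟩
  let f : (Σ x : Ioc a s, Fin (j x)) → Ico (h a) (h s) := fun c =>
    ⟨h c.1 - j c.1 + c.2, by have := hle c.1 c.1.2; exact ⟨by omega, by omega⟩⟩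
  have hf : ∀ c, (f c : ℕ) ∈ Ico (h c.1 - j c.1) (h c.1) := fun c => by
    have := hle c.1 c.1.2
    exact ⟨Nat.le_add_right _ _, show h c.1 - j c.1 + c.2 < h c.1 by omega⟩
  have hf_bijective : f.Bijective := by
    constructor
    · rintro ⟨x, i⟩ ⟨y, i'⟩ heq
      obtain rfl : x = y := Subtype.ext <|
        (existsUnique_mem_Ico_jump hmono hright hleft has (f ⟨x, i⟩).2).unique
          ⟨x.2, hf ⟨x, i⟩⟩ ⟨y.2, heq ▸ hf ⟨y, i'⟩⟩
      have hval : h x - j x + i = h x - j x + i' := congrArg Subtype.val heq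
      rw [Fin.ext (Nat.add_left_cancel hval)]
    · rintro ⟨n, hn⟩
      obtain ⟨x, ⟨hx, hnx⟩, -⟩ := existsUnique_mem_Ico_jump hmono hright hleft has hn
      have := hle x hx
      have hi : n - (h x - j x) < j x := by have := mem_Ico.1 hnx; omega
      exact ⟨⟨⟨x, hx⟩, n - (h x - j x), hi⟩, Subtype.ext (Nat.add_sub_cancel' hnx.1)⟩
  exact mk_eq_nat_iff.2 ⟨(Equiv.ofBijective f hf_bijective).trans
    (Fintype.equivFinOfCardEq (by simp))⟩

theorem mk_sigma_fin_eq_of_subset {β : Type*} {j : β → ℕ} {S T : Set β} (hST : S ⊆ T)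
    (hj : ∀ x ∈ T \ S, j x = 0) : #(Σ x : T, Fin (j x)) = #(Σ x : S, Fin (j x)) := by
  refine mk_congr (Equiv.ofBijective (Sigma.map (inclusion hST) fun _ => id) ⟨?_, ?_⟩).symm
  · exact (inclusion_injective hST).sigma_map fun _ => Function.injective_id
  · rintro ⟨⟨x, hxT⟩, i⟩
    by_cases hxS : x ∈ S
    · exact ⟨⟨⟨x, hxS⟩, i⟩, rfl⟩
    · exact (Fin.cast (hj x ⟨hxT, hxS⟩) i).elim0

end StepFunctions

section Multiplicities

theorem tendsto_const_add_nhdsGT_zero (x : ℝ) : Tendsto (x + ·) (𝓝[>] 0) (𝓝[>] x) :=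
  (map_add_left_nhdsGT.trans (by rw [add_zero])).le

theorem tendsto_const_sub_nhdsGT_zero (x : ℝ) : Tendsto (x - ·) (𝓝[>] 0) (𝓝[<] x) :=
  (map_subLeft_nhdsGT.trans (by rw [sub_zero])).le

theorem isLeast_natCast_sInf {β : Type*} {s : Set β} {F : β → ℤ} (hs : s.Nonempty)
    (hF : ∀ b ∈ s, 0 ≤ F b) : IsLeast (F '' s) (sInf {n : ℕ | ∃ b ∈ s, (n : ℤ) = F b} : ℕ) := by
  have htoNat (b : β) (hb : b ∈ s) : (F b).toNat ∈ {n : ℕ | ∃ b ∈ s, (n : ℤ) = F b} :=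
    ⟨b, hb, Int.toNat_of_nonneg (hF b hb)⟩
  obtain ⟨b, hb, heq⟩ := Nat.sInf_mem (hs.elim fun b hb => ⟨_, htoNat b hb⟩)
  exact ⟨⟨b, hb, heq.symm⟩, forall_mem_image.2 fun b hb =>
    (Nat.cast_le.2 (Nat.sInf_le (htoNat b hb))).trans_eq (Int.toNat_of_nonneg (hF b hb))⟩

namespace IsRankFunction

variable {ℓ : ℝ → ℝ → ℕ} (hℓ : IsRankFunction ℓ) {x y z : ℝ}
include hℓ

theorem monotoneOn_left (hxy : x < y) : MonotoneOn (ℓ · y) (Iic x) :=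
  fun _ _ _ hv huv => hℓ.monotone_left huv (lt_of_le_of_lt hv hxy)

theorem eventually_add_leftJump (hxy : x < y) :
    ∀ᶠ u in 𝓝[<] x, ℓ u y + leftJump (ℓ · y) x = ℓ x y :=
  SizeTheory.eventually_add_leftJump (hℓ.monotoneOn_left hxy)

theorem exists_add_leftJump (hxy : x < y) (hxz : x < z) {v : ℝ} (hvx : v < x) : ∃ u ∈ Ioo v x,
    ℓ u y + leftJump (ℓ · y) x = ℓ x y ∧ ℓ u z + leftJump (ℓ · z) x = ℓ x z :=
  (Eventually.and (Ioo_mem_nhdsLT hvx)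
    ((hℓ.eventually_add_leftJump hxy).and (hℓ.eventually_add_leftJump hxz))).exists

theorem add_leftJump_le (hxy : x < y) {v : ℝ} (hvx : v < x) :
    ℓ v y + leftJump (ℓ · y) x ≤ ℓ x y := by
  obtain ⟨u, hu, huy, -⟩ := hℓ.exists_add_leftJump hxy hxy hvx
  have := hℓ.monotone_left hu.1.le (hu.2.trans hxy)
  omega

theorem antitone_right (hxy : x < y) (hyz : y ≤ z) : ℓ x z ≤ ℓ x y := by
  obtain ⟨a, ha⟩ := hℓ.exists_eq_zero
  have hle := hℓ.rectangle_nonneg (min_le_right a x) hxy hyz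
  have hy := ha (min_le_left a x) ((min_le_right a x).trans_lt hxy)
  have hz := ha (min_le_left a x) ((min_le_right a x).trans_lt (hxy.trans_le hyz))
  omega

theorem leftJump_antitone (hxy : x < y) (hyz : y ≤ z) :
    leftJump (ℓ · z) x ≤ leftJump (ℓ · y) x := by
  obtain ⟨u, hu, huy, huz⟩ := hℓ.exists_add_leftJump hxy (hxy.trans_le hyz) (sub_one_lt x)
  have := hℓ.rectangle_nonneg hu.2.le hxy hyz
  omega

theorem eventually_leftJump_eq (hxy : x < y) :
    ∀ᶠ z in 𝓝[>] y, leftJump (ℓ · z) x = leftJump (ℓ · y) x := by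
  filter_upwards [hℓ.eventually_right_eq hxy, self_mem_nhdsWithin] with z hxz hyz
  obtain ⟨u, hu, huy, huz⟩ := hℓ.exists_add_leftJump hxy (hxy.trans hyz) (sub_one_lt x)
  have := hℓ.antitone_right (hu.2.trans hxy) (le_of_lt hyz)
  have := hℓ.leftJump_antitone hxy (le_of_lt hyz)
  omega

theorem isLeast_properMult (hxy : x < y) :
    IsLeast ((fun ε => (ℓ (x + ε) (y - ε) - ℓ (x - ε) (y - ε) - ℓ (x + ε) (y + ε) +
      ℓ (x - ε) (y + ε) : ℤ)) '' {ε | 0 < ε ∧ x + ε < y - ε}) (properMult ℓ x y) := by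
  have hne : {ε | 0 < ε ∧ x + ε < y - ε}.Nonempty := ⟨(y - x) / 4, by constructor <;> linarith⟩
  convert isLeast_natCast_sInf hne fun ε hε => ?_ using 2
  · simp only [properMult, mem_ofPred_eq, and_assoc]
  · have := hℓ.rectangle_nonneg (x₁ := x - ε) (x₂ := x + ε) (y₁ := y - ε) (y₂ := y + ε)
      (by linarith [hε.1]) hε.2 (by linarith [hε.1])
    omega

theorem properMult_add_leftJump_le (hxz : x < z) (hzy : z < y) :
    properMult ℓ x y + leftJump (ℓ · y) x ≤ leftJump (ℓ · z) x := by
  have hxy := hxz.trans hzy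
  refine (eventually_const (f := 𝓝[>] (0 : ℝ))).1 ?_
  filter_upwards [(tendsto_const_sub_nhdsGT_zero x).eventually (hℓ.eventually_add_leftJump hxz),
    (tendsto_const_add_nhdsGT_zero x).eventually (hℓ.eventually_left_eq hxz),
    (tendsto_const_add_nhdsGT_zero y).eventually (hℓ.eventually_leftJump_eq hxy),
    Ioo_mem_nhdsGT (show 0 < (y - z) / 2 by linarith),
    Ioo_mem_nhdsGT (show 0 < (z - x) / 2 by linarith)] with ε hleft hright hjump hεy hεx
  have hε := hεy.1
  -- Extending the box around `(x, y)` down to `z` does not decrease its mass, which then is at most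
  -- the difference of the jumps at the levels `z` and `y`.
  have hmult := (hℓ.isLeast_properMult hxy).2
    (mem_image_of_mem _ ⟨hε, by linarith [hεy.2, hεx.2]⟩)
  have := hℓ.rectangle_nonneg (x₁ := x - ε) (x₂ := x + ε) (y₁ := z) (y₂ := y - ε) (by linarith)
    (by linarith [hεx.2]) (by linarith [hεy.2])
  have := hℓ.add_leftJump_le (x := x) (y := y + ε) (v := x - ε) (by linarith) (by linarith)
  have := hℓ.monotone_left (x₁ := x) (x₂ := x + ε) (y := y + ε) (by linarith) (by linarith)
  omega

theorem eventually_leftJump_add_properMult (hxy : x < y) :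
    ∀ᶠ z in 𝓝[<] y, leftJump (ℓ · z) x = leftJump (ℓ · y) x + properMult ℓ x y := by
  obtain ⟨ε, ⟨hε, hxε⟩, hmult⟩ := (hℓ.isLeast_properMult hxy).1
  dsimp only at hmult
  filter_upwards [Ioo_mem_nhdsLT (show y - ε < y by linarith)] with z hz
  have hxz : x < z := by linarith [hz.1]
  have hge := hℓ.properMult_add_leftJump_le hxz hz.2
  obtain ⟨u, hu, huz, huy⟩ := hℓ.exists_add_leftJump hxz hxy (show x - ε < x by linarith)
  -- The box realising the minimum contains `[u, x] × [z, y]`, and the rest of it is cut into four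
  -- boxes of non-negative mass.
  have := hℓ.rectangle_nonneg (x₁ := u) (x₂ := x) hu.2.le (by linarith) hz.1.le
  have := hℓ.rectangle_nonneg (x₁ := x - ε) (x₂ := u) (y₁ := y - ε) (y₂ := y) hu.1.le
    (by linarith [hu.2]) (by linarith)
  have := hℓ.rectangle_nonneg (x₁ := x) (x₂ := x + ε) (y₁ := y - ε) (y₂ := y) (by linarith) hxε
    (by linarith)
  have := hℓ.rectangle_nonneg (x₁ := x - ε) (x₂ := x + ε) (y₁ := y) (y₂ := y + ε) (by linarith)
    (by linarith) (by linarith)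
  omega

theorem eventually_sub_eq_leftJump {B : ℝ}
    (hB : ∀ {x y y'}, B ≤ y → B ≤ y' → x < y → x < y' → ℓ x y = ℓ x y') {T : ℝ} (hBT : B ≤ T)
    (hxT : x < T) : ∀ᶠ ε in 𝓝[>] 0, x + ε < 1 / ε ∧
      (ℓ (x + ε) (1 / ε) - ℓ (x - ε) (1 / ε) : ℤ) = leftJump (ℓ · T) x := by
  simp only [one_div]
  filter_upwards [(tendsto_const_sub_nhdsGT_zero x).eventually (hℓ.eventually_add_leftJump hxT),
    (tendsto_const_add_nhdsGT_zero x).eventually (hℓ.eventually_left_eq hxT),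
    tendsto_inv_nhdsGT_zero.eventually_ge_atTop T,
    Ioo_mem_nhdsGT (sub_pos.2 hxT)] with ε hleft hright hTε hε
  have hxεT : x + ε < T := by linarith [hε.2]
  have hxεT' : x - ε < T := by linarith [hε.1]
  have := hB (hBT.trans hTε) hBT (hxεT.trans_le hTε) hxεT
  have := hB (hBT.trans hTε) hBT (hxεT'.trans_le hTε) hxεT'
  exact ⟨hxεT.trans_le hTε, by omega⟩

theorem isLeast_infinityMult (x : ℝ) :
    IsLeast ((fun ε => (ℓ (x + ε) (1 / ε) - ℓ (x - ε) (1 / ε) : ℤ)) ''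
      {ε | 0 < ε ∧ x + ε < 1 / ε}) (infinityMult ℓ x) := by
  have hne : {ε | 0 < ε ∧ x + ε < 1 / ε}.Nonempty := by
    refine Eventually.exists (f := 𝓝[>] (0 : ℝ)) ?_
    filter_upwards [tendsto_inv_nhdsGT_zero.eventually_ge_atTop (x + 1),
      Ioo_mem_nhdsGT one_pos] with ε hxε hε
    exact ⟨hε.1, by rw [one_div]; linarith [hε.2]⟩
  convert isLeast_natCast_sInf hne fun ε hε => ?_ using 2
  · simp only [infinityMult, mem_ofPred_eq, and_assoc]
  · have := hℓ.monotone_left (x₁ := x - ε) (x₂ := x + ε) (by linarith [hε.1]) hε.2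
    omega

theorem exists_leftJump_eq_infinityMult :
    ∃ B, ∀ {x T}, B ≤ T → x < T → leftJump (ℓ · T) x = infinityMult ℓ x := by
  obtain ⟨B, hB⟩ := hℓ.exists_eq_of_le
  refine ⟨B, fun {x T} hBT hxT => le_antisymm ?_ ?_⟩
  · obtain ⟨ε, ⟨hε, hxε⟩, hmult⟩ := (hℓ.isLeast_infinityMult x).1
    dsimp only at hmult
    have hT' : T ≤ max (1 / ε) T := le_max_right _ _
    have := hℓ.rectangle_nonneg (x₁ := x - ε) (by linarith) hxε (le_max_left (1 / ε) T)
    have := hℓ.monotone_left (x₁ := x) (x₂ := x + ε) (by linarith)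
      (hxε.trans_le (le_max_left _ T))
    have := hB hBT (hBT.trans hT') hxT (hxT.trans_le hT')
    have := hB (x := x - ε) hBT (hBT.trans hT') (by linarith) (by linarith)
    have := hℓ.add_leftJump_le hxT (show x - ε < x by linarith)
    omega
  · obtain ⟨ε, ⟨hxε, heq⟩, hε⟩ :=
      ((hℓ.eventually_sub_eq_leftJump hB hBT hxT).and self_mem_nhdsWithin).exists
    exact_mod_cast heq ▸ (hℓ.isLeast_infinityMult x).2 (mem_image_of_mem _ ⟨hε, hxε⟩)

end IsRankFunction

end Multiplicities

section Counting

open Cardinal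

/-- The closed upper-left quadrant of `(s, t)`, with the side `y = t` removed: the region in which
a size function counts the cornerpoints at `(s, t)`. -/
def ExtPoint.UpperLeft (s t : ℝ) : ExtPoint → Prop
  | .proper x y => x ≤ s ∧ t < y
  | .atInfinity x => x ≤ s

theorem mult_proper (ℓ : ℝ → ℝ → ℕ) {x y : ℝ} (hxy : x < y) :
    mult ℓ (.proper x y) = properMult ℓ x y :=
  if_pos hxy

theorem mult_atInfinity (ℓ : ℝ → ℝ → ℕ) (x : ℝ) : mult ℓ (.atInfinity x) = infinityMult ℓ x :=
  rfl

/-- The points of the diagram in an upper-left quadrant, grouped by abscissa. -/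
noncomputable def upperLeftEquivSigma (ℓ : ℝ → ℝ → ℕ) {s t : ℝ} (hst : s < t) :
    {c : Diagram ℓ // c.1.UpperLeft s t} ≃
      Σ x : Iic s, (Σ y : Ioi t, Fin (properMult ℓ x y)) ⊕ Fin (infinityMult ℓ x) where
  toFun
    | ⟨⟨.proper x y, n⟩, hc⟩ => ⟨⟨x, hc.1⟩, .inl ⟨⟨y, hc.2⟩, n.1, Nat.cast_lt.1
        (n.2.trans_eq (mult_proper ℓ (hc.1.trans_lt (hst.trans hc.2))))⟩⟩
    | ⟨⟨.atInfinity x, n⟩, hc⟩ => ⟨⟨x, hc⟩, .inr ⟨n.1, Nat.cast_lt.1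
        (n.2.trans_eq (mult_atInfinity ℓ x))⟩⟩
  invFun
    | ⟨x, .inl ⟨y, i⟩⟩ => ⟨⟨.proper x y, i.1, (Nat.cast_lt.2 i.2).trans_eq
        (mult_proper ℓ (x.2.trans_lt (hst.trans y.2))).symm⟩, x.2, y.2⟩
    | ⟨x, .inr i⟩ => ⟨⟨.atInfinity x, i.1, (Nat.cast_lt.2 i.2).trans_eq
        (mult_atInfinity ℓ x).symm⟩, x.2⟩
  left_inv := by rintro ⟨⟨_ | _, n⟩, hc⟩ <;> rfl
  right_inv := by rintro ⟨x, y | i⟩ <;> rfl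

namespace IsRankFunction

variable {ℓ : ℝ → ℝ → ℕ} (hℓ : IsRankFunction ℓ) {x s t : ℝ}
include hℓ

theorem mk_sigma_fin_leftJump (hst : s < t) :
    #(Σ x : Iic s, Fin (leftJump (ℓ · t) x)) = ℓ s t := by
  obtain ⟨a, ha⟩ := hℓ.exists_eq_zero
  have hzero {x : ℝ} (hx : x ≤ min a s) : ℓ x t = 0 :=
    ha (hx.trans (min_le_left a s)) ((hx.trans (min_le_right a s)).trans_lt hst)
  have hjump : ∀ x ∈ Iic s \ Ioc (min a s) s, leftJump (ℓ · t) x = 0 := fun x hx => by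
    rw [leftJump, hzero (not_lt.1 fun hlt => hx.2 ⟨hlt, hx.1⟩), Nat.zero_sub]
  rw [mk_sigma_fin_eq_of_subset Ioc_subset_Iic_self hjump, mk_sigma_fin_jump_Ioc
    ((hℓ.monotoneOn_left hst).mono Icc_subset_Iic_self)
    (fun x hx => hℓ.eventually_left_eq (hx.2.trans hst))
    (fun x hx => hℓ.eventually_add_leftJump (hx.2.trans_lt hst)) (min_le_right a s),
    hzero le_rfl, Nat.sub_zero]

theorem mk_sigma_fin_properMult_add (hxt : x < t) :
    #(Σ y : Ioi t, Fin (properMult ℓ x y)) + infinityMult ℓ x = leftJump (ℓ · t) x := by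
  obtain ⟨B, hB⟩ := hℓ.exists_leftJump_eq_infinityMult
  let J : ℝ → ℕ := fun y => leftJump (ℓ · y) x
  have hJB : ∀ y ≥ max B t, J y = infinityMult ℓ x := fun y hy =>
    hB ((le_max_left B t).trans hy) (hxt.trans_le ((le_max_right B t).trans hy))
  have hJ : ∀ {y z}, t ≤ y → y ≤ z → J z ≤ J y := fun hy hyz =>
    hℓ.leftJump_antitone (hxt.trans_le hy) hyz
  -- `J` decreases, so the jumps counted are those of `J t - J ·`.
  have hleft : ∀ y > t, ∀ᶠ z in 𝓝[<] y, (J t - J z) + properMult ℓ x y = J t - J y := by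
    intro y hy
    filter_upwards [hℓ.eventually_leftJump_add_properMult (hxt.trans hy), Ioo_mem_nhdsLT hy]
      with z (hz : J z = J y + _) hzy
    have := hJ le_rfl hzy.1.le
    omega
  have hright : ∀ y ≥ t, ∀ᶠ z in 𝓝[>] y, J t - J z = J t - J y := fun y hy =>
    (hℓ.eventually_leftJump_eq (hxt.trans_le hy)).mono fun z hz => congrArg (J t - ·) hz
  have hzero : ∀ y ∈ Ioi t \ Ioc t (max B t), properMult ℓ x y = 0 := by
    rintro y ⟨hy : t < y, hyB⟩
    have hBy : max B t < y := not_le.1 fun hle => hyB ⟨hy, hle⟩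
    obtain ⟨z, hz, hzy⟩ := ((hleft y hy).and (Ioo_mem_nhdsLT hBy)).exists
    have := hJB y hBy.le
    have := hJB z hzy.1.le
    omega
  rw [mk_sigma_fin_eq_of_subset Ioc_subset_Ioi_self hzero,
    mk_sigma_fin_jump_Ioc (h := fun y => J t - J y)
    (fun y hy z _ hyz => Nat.sub_le_sub_left (hJ hy.1 hyz) _) (fun y hy => hright y hy.1)
    (fun y hy => hleft y hy.1) (le_max_right B t), ← Nat.cast_add]
  have := hJ le_rfl (le_max_right B t)
  have := hJB (max B t) le_rfl
  exact congrArg Nat.cast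
    (show J t - J (max B t) - (J t - J t) + infinityMult ℓ x = J t by omega)

theorem mk_upperLeft (hst : s < t) : #{c : Diagram ℓ // c.1.UpperLeft s t} = ℓ s t := by
  have hcolumn (x : Iic s) : #((Σ y : Ioi t, Fin (properMult ℓ x y)) ⊕ Fin (infinityMult ℓ x)) =
      #(Fin (leftJump (ℓ · t) x)) := by
    rw [mk_sum, lift_id, lift_id, mk_fin, mk_fin,
      hℓ.mk_sigma_fin_properMult_add (lt_of_le_of_lt x.2 hst)]
  rw [mk_congr (upperLeftEquivSigma ℓ hst), mk_sigma_congrRight hcolumn,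
    hℓ.mk_sigma_fin_leftJump hst]

end IsRankFunction

end Counting

section Matching

open Cardinal

theorem ExtPoint.UpperLeft.of_pointCost_lt {p q : ExtPoint} {s t ε : ℝ}
    (hp : p.UpperLeft s (t + ε)) (hst : s + ε < t) (hpq : pointCost p q < ENNReal.ofReal ε) :
    q.UpperLeft (s + ε) t := by
  match p, q with
  | .proper x y, .proper x' y' =>
    obtain ⟨hx, hy⟩ := hp
    obtain hnear | hdiagonal := min_lt_iff.1 (ENNReal.ofReal_lt_ofReal_iff'.1 hpq).1
    · obtain ⟨hxx', hyy'⟩ := max_lt_iff.1 hnear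
      exact ⟨by linarith [neg_lt_of_abs_lt hxx'], by linarith [lt_of_abs_lt hyy']⟩
    · linarith [(max_lt_iff.1 hdiagonal).1]
  | .atInfinity x, .atInfinity x' =>
    have hxx' := neg_lt_of_abs_lt (ENNReal.ofReal_lt_ofReal_iff'.1 hpq).1
    exact show x' ≤ s + ε by linarith [show x ≤ s from hp]
  | .proper _ _, .atInfinity _ => exact absurd hpq not_top_lt
  | .atInfinity _, .proper _ _ => exact absurd hpq not_top_lt

theorem pointCost_self (p : ExtPoint) : pointCost p p = 0 := by
  cases p <;> simp [pointCost]

theorem pointCost_comm (p q : ExtPoint) : pointCost p q = pointCost q p := by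
  cases p <;> cases q <;> simp only [pointCost, abs_sub_comm, max_comm]

theorem matchingDist_comm (ℓ₁ ℓ₂ : ℝ → ℝ → ℕ) : matchingDist ℓ₁ ℓ₂ = matchingDist ℓ₂ ℓ₁ :=
  (Equiv.symmEquiv _ _).iInf_congr fun σ => σ.symm.iSup_congr fun c => by
    rw [Equiv.apply_symm_apply, pointCost_comm]
    rfl

theorem mult_congr {ℓ₁ ℓ₂ : ℝ → ℝ → ℕ} (h : ∀ s t, s < t → ℓ₁ s t = ℓ₂ s t) :
    mult ℓ₁ = mult ℓ₂ := by
  have hproper (x y : ℝ) : properMult ℓ₁ x y = properMult ℓ₂ x y := by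
    refine congrArg sInf (ext fun n => exists_congr fun ε =>
      and_congr_right fun hε => and_congr_right fun hxy => ?_)
    rw [h (x + ε) (y - ε) hxy, h (x - ε) (y - ε) (by linarith), h (x + ε) (y + ε) (by linarith),
      h (x - ε) (y + ε) (by linarith)]
  have hinfinity (x : ℝ) : infinityMult ℓ₁ x = infinityMult ℓ₂ x := by
    refine congrArg sInf (ext fun n => exists_congr fun ε =>
      and_congr_right fun hε => and_congr_right fun hx => ?_)
    rw [h (x + ε) (1 / ε) hx, h (x - ε) (1 / ε) (by linarith)]
  funext p
  cases p <;> simp only [mult, hproper, hinfinity]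

theorem matchingDist_eq_zero_of_eq {ℓ₁ ℓ₂ : ℝ → ℝ → ℕ} (h : ∀ s t, s < t → ℓ₁ s t = ℓ₂ s t) :
    matchingDist ℓ₁ ℓ₂ = 0 := by
  let σ : Diagram ℓ₁ ≃ Diagram ℓ₂ := Equiv.sigmaCongrRight fun p =>
    Equiv.subtypeEquivRight fun n => by rw [mult_congr h]
  exact le_antisymm (iInf_le_of_le σ (iSup_le fun c => (pointCost_self c.1).le)) bot_le

namespace IsRankFunction

variable {ℓ₁ ℓ₂ : ℝ → ℝ → ℕ} (h₁ : IsRankFunction ℓ₁) (h₂ : IsRankFunction ℓ₂) {s t : ℝ}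
include h₁ h₂

theorem le_of_matchingDist_lt {ε : ℝ} (hdist : matchingDist ℓ₁ ℓ₂ < ENNReal.ofReal ε)
    (hst : s + ε < t) : ℓ₁ s (t + ε) ≤ ℓ₂ (s + ε) t := by
  have hε : 0 < ε := ENNReal.ofReal_pos.1 (pos_of_gt hdist)
  obtain ⟨σ, hσ⟩ := iInf_lt_iff.1 hdist
  have hmaps (c : Diagram ℓ₁) (hc : c.1.UpperLeft s (t + ε)) : (σ c).1.UpperLeft (s + ε) t :=
    hc.of_pointCost_lt hst ((le_iSup (fun c => pointCost c.1 (σ c).1) c).trans_lt hσ)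
  have hcard : #{c : Diagram ℓ₁ // c.1.UpperLeft s (t + ε)} ≤
      #{c : Diagram ℓ₂ // c.1.UpperLeft (s + ε) t} :=
    mk_le_of_injective (f := Subtype.map σ hmaps) (Subtype.map_injective _ σ.injective)
  rwa [h₁.mk_upperLeft (by linarith), h₂.mk_upperLeft hst, Nat.cast_le] at hcard

theorem le_of_matchingDist_eq_zero (hdist : matchingDist ℓ₁ ℓ₂ = 0) (hst : s < t) :
    ℓ₁ s t ≤ ℓ₂ s t := by
  refine (eventually_const (f := 𝓝[>] (0 : ℝ))).1 ?_
  filter_upwards [(tendsto_const_add_nhdsGT_zero t).eventually (h₁.eventually_right_eq hst),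
    (tendsto_const_add_nhdsGT_zero s).eventually (h₂.eventually_left_eq hst),
    Ioo_mem_nhdsGT (sub_pos.2 hst)] with ε ht hs hε
  rw [← ht, ← hs]
  exact h₁.le_of_matchingDist_lt h₂ (hdist ▸ ENNReal.ofReal_pos.2 hε.1) (by linarith [hε.2])

theorem matchingDist_eq_zero_iff :
    matchingDist ℓ₁ ℓ₂ = 0 ↔ ∀ s t, s < t → ℓ₁ s t = ℓ₂ s t :=
  ⟨fun hdist _ _ hst => le_antisymm (h₁.le_of_matchingDist_eq_zero h₂ hdist hst)
    (h₂.le_of_matchingDist_eq_zero h₁ (matchingDist_comm ℓ₁ ℓ₂ ▸ hdist) hst),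
    matchingDist_eq_zero_of_eq⟩

end IsRankFunction

end Matching

section Leaves

variable {X Y : Type*} {k : ℕ} [NeZero k] {l : Fin k → ℝ}

theorem sublevel_foliationFunction (φ : X → Fin k → ℝ) (hl : ∀ i, 0 < l i) (b : Fin k → ℝ)
    (s : ℝ) : sublevel (foliationFunction φ l b) s = sublevel φ (s • l + b) := by
  ext P
  refine (ciSup_le_iff (finite_range fun i => (φ P i - b i) / l i).bddAbove).trans
    (forall_congr' fun i => ?_)
  rw [div_le_iff₀ (hl i), sub_le_iff_le_add]
  rfl

theorem exists_admissible_leaf {x y : Fin k → ℝ} (hxy : ∀ i, x i < y i) :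
    ∃ l b : Fin k → ℝ, Admissible l b ∧ ∃ s t : ℝ, s < t ∧ s • l + b = x ∧ t • l + b = y := by
  have hsq : 0 < ∑ i, (y i - x i) ^ 2 :=
    Finset.sum_pos (fun i _ => pow_pos (sub_pos.2 (hxy i)) 2) Finset.univ_nonempty
  let r := √(∑ i, (y i - x i) ^ 2)
  have hr : 0 < r := Real.sqrt_pos.2 hsq
  let l : Fin k → ℝ := fun i => (y i - x i) / r
  have hl : ∀ i, 0 < l i := fun i => div_pos (sub_pos.2 (hxy i)) hr
  have hl_sq : ∑ i, l i ^ 2 = 1 := by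
    simp only [l, div_pow]
    rw [← Finset.sum_div, Real.sq_sqrt hsq.le, div_self hsq.ne']
  have hl_sum : 0 < ∑ i, l i := Finset.sum_pos (fun i _ => hl i) Finset.univ_nonempty
  let s := (∑ i, x i) / ∑ i, l i
  refine ⟨l, x - s • l, ⟨hl_sq, hl, ?_⟩, s, s + r, lt_add_of_pos_right s hr,
    add_sub_cancel _ _, ?_⟩
  · simp only [Pi.sub_apply, Pi.smul_apply, smul_eq_mul, Finset.sum_sub_distrib, ← Finset.mul_sum]
    rw [div_mul_cancel₀ _ hl_sum.ne', sub_self]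
  · have hrl : r • l = y - x := funext fun i => mul_div_cancel₀ _ hr.ne'
    rw [add_smul, hrl]
    abel

variable [TopologicalSpace X] [TopologicalSpace Y]

theorem continuous_foliationFunction {φ : X → Fin k → ℝ} (hφ : Continuous φ) (l b : Fin k → ℝ) :
    Continuous (foliationFunction φ l b) := by
  have hsup : foliationFunction φ l b = fun P =>
      Finset.univ.sup' Finset.univ_nonempty fun i => (φ P i - b i) / l i :=
    funext fun P => (Finset.sup'_univ_eq_ciSup _).symm
  rw [hsup]
  exact Continuous.finset_sup'_apply _ fun i _ => by fun_prop

theorem sizeFunction_foliationFunction (φ : X → Fin k → ℝ) (hl : ∀ i, 0 < l i)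
    (b : Fin k → ℝ) (s t : ℝ) :
    sizeFunction (foliationFunction φ l b) s t = sizeFunction φ (s • l + b) (t • l + b) := by
  simp only [sizeFunction, levelClasses, LevelConnected, sublevel_foliationFunction φ hl b]

theorem sizeFunction_eq_iff_foliationFunction (φ : X → Fin k → ℝ) (ψ : Y → Fin k → ℝ) :
    (∀ x y : Fin k → ℝ, (∀ i, x i < y i) → sizeFunction φ x y = sizeFunction ψ x y) ↔
      ∀ l b : Fin k → ℝ, Admissible l b → ∀ s t, s < t →
        sizeFunction (foliationFunction φ l b) s t =
          sizeFunction (foliationFunction ψ l b) s t := by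
  constructor
  · intro h l b hlb s t hst
    rw [sizeFunction_foliationFunction φ hlb.2.1, sizeFunction_foliationFunction ψ hlb.2.1]
    exact h _ _ fun i => add_lt_add_left (mul_lt_mul_of_pos_right hst (hlb.2.1 i)) (b i)
  · intro h x y hxy
    obtain ⟨l, b, hlb, s, t, hst, rfl, rfl⟩ := exists_admissible_leaf hxy
    rw [← sizeFunction_foliationFunction φ hlb.2.1, ← sizeFunction_foliationFunction ψ hlb.2.1]
    exact h l b hlb s t hst

end Leaves

end SizeTheory

theorem mainTheorem4 {M : Type*} {N : Type*}
    [TopologicalSpace M] [Nonempty M] [CompactSpace M] [LocallyConnectedSpace M] [T2Space M]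
    [TopologicalSpace N] [Nonempty N] [CompactSpace N] [LocallyConnectedSpace N] [T2Space N]
    {k : ℕ} (hk : 1 ≤ k)
    (φ : M → Fin k → ℝ) (hφ : Continuous φ) (ψ : N → Fin k → ℝ) (hψ : Continuous ψ) :
    (∀ x y : Fin k → ℝ, (∀ i, x i < y i) →
        SizeTheory.sizeFunction φ x y = SizeTheory.sizeFunction ψ x y) ↔
      ∀ l b : Fin k → ℝ, SizeTheory.Admissible l b →
        SizeTheory.matchingDist
          (SizeTheory.sizeFunction (SizeTheory.foliationFunction φ l b))
          (SizeTheory.sizeFunction (SizeTheory.foliationFunction ψ l b)) = 0 := by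
  have : NeZero k := ⟨by omega⟩
  have hM (l b) := SizeTheory.isRankFunction_sizeFunction
    (SizeTheory.continuous_foliationFunction hφ l b)
  have hN (l b) := SizeTheory.isRankFunction_sizeFunction
    (SizeTheory.continuous_foliationFunction hψ l b)
  rw [SizeTheory.sizeFunction_eq_iff_foliationFunction φ ψ]
  exact forall₃_congr fun l b _ => ((hM l b).matchingDist_eq_zero_iff (hN l b)).symm
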